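/- Let $\mu$ be a partition of an integer $w\ge 0$ and let $Q$ be a standard Young tableau of shape $\mu$. Extend RSK (row insertion, in which an inserted letter bumps the leftmost strictly larger entry of a row) to words $v=(v_1,\dots,v_w)\in\mathbb R^w$; the insertion tableau then has real entries and the recording tableau is a standard Young tableau with entries $1,\dots,w$. For real $r\ge 0$ put $$\mathrm{Ch}_r(Q)=\{v\in[0,r]^w : \text{the recording tableau of } \mathrm{RSK}(v) \text{ is } Q\},\qquad \mathrm{Ch}(Q)=\mathrm{Ch}_1(Q).$$ For $P\subseteq[0,1]^w$ and an integer $h\geq 0$, the integer-point enumerator of $P$ at height $h$ is $\mathrm{ipe}_P(h;x_0,x_1,\dots)=\sum_{v\in hP\cap\mathbb Z^w}x_{v_1}\cdots x_{v_w}$. Let $s_\mu(x_0,\dots,x_h)=\sum_T x^{\mathrm{wt}(T)}$ be the Schur polynomial, the sum over all semistandard Young tableaux $T$ of shape $\mu$ with entries in $\{0,\dots,h\}$, where $x^{\mathrm{wt}(T)}=\prod_{k=0}^{h} x_k^{\alpha_k}$ and $\alpha_k$ is the number of entries of $T$ equal to $k$. Then for every integer $h\ge 1$, $$\mathrm{ipe}_{\mathrm{Ch}(Q)}(h;x_0,x_1,\dots)=s_\mu(x_0,\dots,x_h).$$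 Moreover, for every integer $h\ge 0$, with the dilate of $\mathrm{Ch}(Q)$ read as $\mathrm{Ch}_h(Q)$ (the same conditions imposed in the dilated cube; this is $h\cdot\mathrm{Ch}(Q)$ when $h\geq 1$), $$\sum_{v\in \mathrm{Ch}_h(Q)\cap\mathbb Z^w}x_{v_1}\cdots x_{v_w}=s_\mu(x_0,\dots,x_h).$$ -/

import Mathlib

open scoped Pointwise

namespace RSKCube

/-! ### Semistandard and standard Young tableaux, Schur polynomials -/

/-- Semistandard Young tableaux of shape `μ` over the alphabet `{0, …, n - 1}`. -/
def SSYT (n : ℕ) (μ : YoungDiagram) : Type :=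
  {T : SemistandardYoungTableau μ // ∀ c ∈ μ.cells, T c.1 c.2 < n}

/-- There are finitely many such tableaux, so that the sum defining `schur` is a genuine one. -/
instance SSYT.instFinite (n : ℕ) (μ : YoungDiagram) : Finite (SSYT n μ) := by
  refine Finite.of_injective
    (fun (T : SSYT n μ) (c : μ.cells) => (⟨T.1 c.1.1 c.1.2, T.2 c.1 c.2⟩ : Fin n)) ?_
  intro T T' h
  apply Subtype.ext
  apply SemistandardYoungTableau.ext
  intro i j
  by_cases hc : (i, j) ∈ μ
  · have := congrFun h ⟨(i, j), hc⟩
    simpa using this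
  · rw [T.1.zeros hc, T'.1.zeros hc]

/-- The weight of a tableau at the letter `k`: the number of cells containing `k`. -/
def wt {n : ℕ} {μ : YoungDiagram} (T : SSYT n μ) (k : Fin n) : ℕ :=
  (μ.cells.filter fun c => T.1 c.1 c.2 = (k : ℕ)).card

/-- The Schur polynomial `s_μ` in `n` variables `x_0, …, x_{n-1}`: the sum of `x ^ wt T` over all
semistandard tableaux `T` of shape `μ` with entries in `{0, …, n - 1}`. -/
noncomputable def schur (n : ℕ) (μ : YoungDiagram) : MvPolynomial (Fin n) ℤ :=
  ∑ᶠ T : SSYT n μ, ∏ k : Fin n, MvPolynomial.X k ^ wt T k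

/-- Standard Young tableaux of shape `μ`: the semistandard tableaux in which each of
`1, …, |μ|` occurs exactly once (rows are then strictly increasing). -/
def SYT (μ : YoungDiagram) : Type :=
  {T : SemistandardYoungTableau μ //
    Set.BijOn (fun c : ℕ × ℕ => T c.1 c.2) (μ.cells : Set (ℕ × ℕ)) (Set.Icc 1 μ.card)}

/-- The list of the rows of a standard tableau, from top to bottom. -/
def SYT.rows {μ : YoungDiagram} (Q : SYT μ) : List (List ℕ) :=
  (List.range (μ.colLen 0)).map fun i => (List.range (μ.rowLen i)).map fun j => Q.1 i j

/-! ### The RSK algorithm on words over a linear order (tableaux are lists of rows) -/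

section RSK

variable {α : Type*} [LinearOrder α]

/-- Insert `x` in a row: it replaces the leftmost entry strictly larger than `x`, which is
bumped out and returned; if there is none, `x` is appended at the end of the row. -/
def rowInsert (x : α) : List α → List α × Option α
  | [] => ([x], none)
  | y :: r =>
    if x < y then (x :: r, some y)
    else (y :: (rowInsert x r).1, (rowInsert x r).2)

/-- Insert `x` in a tableau: insert it in the first row, then the bumped entry in the second row,
and so on. Returns the new tableau and the index (from `0`) of the row that has grown. -/
def tableauInsert (x : α) : List (List α) → List (List α) × ℕ
  | [] => ([[x]], 0)
  | r :: P =>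
    match rowInsert x r with
    | (r', none) => (r' :: P, 0)
    | (r', some y) => (r' :: (tableauInsert y P).1, (tableauInsert y P).2 + 1)

/-- Add the entry `k` at the end of the row of index `i`, opening a new row at the bottom
if there is no such row. -/
def addToRow (k : ℕ) : ℕ → List (List ℕ) → List (List ℕ)
  | _, [] => [[k]]
  | 0, r :: Q => (r ++ [k]) :: Q
  | i + 1, r :: Q => r :: addToRow k i Q

/-- One step of RSK: insert the letter `xk.1`, and record the new cell with the label `xk.2`. -/
def rskStep (PQ : List (List α) × List (List ℕ)) (xk : α × ℕ) :
    List (List α) × List (List ℕ) :=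
  ((tableauInsert xk.1 PQ.1).1, addToRow xk.2 (tableauInsert xk.1 PQ.1).2 PQ.2)

/-- The RSK algorithm: the letters of the word are inserted from left to right and labelled
`1, 2, …`. The result is (insertion tableau, recording tableau). -/
def rsk (word : List α) : List (List α) × List (List ℕ) :=
  (word.zipIdx 1).foldl rskStep ([], [])

end RSK

/-! ### Integer-point enumerators -/

/-- The integer points of a region of `ℝ ^ w`. -/
def intPoints {w : ℕ} (S : Set (Fin w → ℝ)) : Set (Fin w → ℤ) :=
  {v | (fun i => (v i : ℝ)) ∈ S}

/-- A region inside a box has finitely many integer points, so that the sum defining `genFun` is a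
genuine one for it. -/
theorem intPoints_finite {w : ℕ} {S : Set (Fin w → ℝ)} (h : ℕ)
    (hS : ∀ v ∈ S, ∀ i, 0 ≤ v i ∧ v i ≤ h) : (intPoints S).Finite := by
  refine (Set.finite_Icc (fun _ : Fin w => (0 : ℤ)) (fun _ => (h : ℤ))).subset ?_
  intro v hv
  refine ⟨fun i => ?_, fun i => ?_⟩
  · have := (hS _ hv i).1
    exact_mod_cast this
  · have := (hS _ hv i).2
    exact_mod_cast this

/-- The generating function `∑ x_{v_1} ⋯ x_{v_w}` of the integer points `v` of a bounded region `S`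
of the nonnegative orthant of `ℝ ^ w`, in the variables `x_0, x_1, …`. -/
noncomputable def genFun {w : ℕ} (S : Set (Fin w → ℝ)) : MvPolynomial ℕ ℤ :=
  ∑ᶠ v ∈ intPoints S, ∏ i : Fin w, MvPolynomial.X (v i).toNat

/-- The integer-point enumerator at height `h` of `P`: the generating function of the
integer points of the dilate `h P`. -/
noncomputable def ipe {w : ℕ} (P : Set (Fin w → ℝ)) (h : ℕ) : MvPolynomial ℕ ℤ :=
  genFun ((h : ℝ) • P)

/-! ### The coarse chambers -/

/-- The points of the cube `[0, r] ^ w` (where `w = |μ|`) whose RSK recording tableau is `Q`. -/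
def chIn {μ : YoungDiagram} (r : ℝ) (Q : SYT μ) : Set (Fin μ.card → ℝ) :=
  {v | (∀ i, 0 ≤ v i ∧ v i ≤ r) ∧ (rsk (List.ofFn v)).2 = Q.rows}

/-- The half-open region `Ch(Q)` of the unit cube. -/
def Ch {μ : YoungDiagram} (Q : SYT μ) : Set (Fin μ.card → ℝ) :=
  chIn 1 Q

end RSKCube

/-!
The theorem is the RSK correspondence read on words with a fixed recording tableau.

RSK compares letters only, so a strictly increasing map of the alphabet changes neither the
bumping paths nor the recording tableau (`rsk_map`). Applied to multiplication by a positive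
number, this identifies the dilates of the chambers of the unit cube with the chambers of the
dilated cube (`smul_chIn`); applied to the inclusion of `ℕ` in `ℝ`, it identifies the integer
points of `chIn h Q` with the words of length `|μ|` in the letters `0, …, h` whose recording
tableau is `Q`.

By the RSK correspondence, these words are in bijection with the semistandard tableaux of
shape `μ` with entries in `0, …, h`: a word is determined by its pair of tableaux
(`rsk_injective`), and every pair of a semistandard and a standard tableau of the same shape
occurs (`exists_rsk_eq`). Both facts are proved by undoing the last insertion. The largest label
of the recording tableau gives the row that has grown (`addToRow_inj`, `exists_addToRow_eq`),
and the insertion is then undone row by row from that row upwards (`tableauInsert_inj`,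
`exists_tableauInsert_eq`); in a row, the letter bumped down returns to the place of the
rightmost entry smaller than it (`rowInsert_inj`, `exists_rowInsert_eq`). The insertion tableau
contains the letters of the word (`rsk_fst_perm`), so that the bijection preserves monomials, and
summing them gives the Schur polynomial (`genFun_chIn`).

Tableaux are lists of rows in the algorithm and functions on the cells of a Young diagram in the
Schur polynomial; `tableauRows` translates between the two.
-/

namespace RSKCube

section RSKCorrespondence

variable {α : Type*} [LinearOrder α]

/-! ### Semistandard tableaux as lists of rows -/

/-- The row `r` can stand immediately above the row `s` in a semistandard tableau: `r` is at least
as long as `s`, and each entry of `s` is strictly larger than the entry of `r` above it. -/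
def Above : List α → List α → Prop
  | _, [] => True
  | [], _ :: _ => False
  | a :: r, b :: s => a < b ∧ Above r s

/-- Semistandard tableaux presented as lists of rows. Rows are nonempty, so that the list is
determined by the tableau; that row lengths decrease is part of `Above`. -/
def IsSemistandard : List (List α) → Prop
  | [] => True
  | r :: P => r ≠ [] ∧ r.Pairwise (· ≤ ·) ∧ Above r (P.headD []) ∧ IsSemistandard P

@[simp] theorem above_nil (r : List α) : Above r [] := by cases r <;> trivial

@[simp] theorem not_nil_above_cons (b : α) (s : List α) : ¬ Above [] (b :: s) := id

@[simp] theorem cons_above_cons {a b : α} {r s : List α} :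
    Above (a :: r) (b :: s) ↔ a < b ∧ Above r s := Iff.rfl

theorem Above.length_le {r s : List α} (h : Above r s) : s.length ≤ r.length := by
  induction r generalizing s with
  | nil => cases s with
    | nil => simp
    | cons b s => exact absurd h (not_nil_above_cons b s)
  | cons a r ih => cases s with
    | nil => simp
    | cons b s => simpa using ih h.2

theorem Above.of_append_right {r s t : List α} (h : Above r (s ++ t)) : Above r s := by
  induction s generalizing r with
  | nil => simp
  | cons b s ih => cases r with
    | nil => exact absurd h (not_nil_above_cons b _)
    | cons a r => exact ⟨h.1, ih h.2⟩

theorem Above.of_append_left {r s t : List α} (h : Above (r ++ t) s) (hl : s.length ≤ r.length) :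
    Above r s := by
  induction r generalizing s with
  | nil => cases s with
    | nil => simp
    | cons b s => simp at hl
  | cons a r ih => cases s with
    | nil => simp
    | cons b s => exact ⟨h.1, ih h.2 (by simpa using hl)⟩

theorem Above.getD_lt [Zero α] {r s : List α} (h : Above r s) {j : ℕ} (hj : j < s.length) :
    r.getD j 0 < s.getD j 0 := by
  induction r generalizing s j with
  | nil => cases s with
    | nil => simp at hj
    | cons b s => exact absurd h (not_nil_above_cons b s)
  | cons a r ih => cases s with
    | nil => simp at hj
    | cons b s => cases j with
      | zero => simpa using h.1
      | succ j => simpa using ih h.2 (by simpa using hj)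

theorem above_of_getElem {r s : List α} (hl : s.length ≤ r.length)
    (h : ∀ (j : ℕ) (hj : j < s.length), r[j]'(hj.trans_le hl) < s[j]) : Above r s := by
  induction r generalizing s with
  | nil => cases s with
    | nil => simp
    | cons b s => simp at hl
  | cons a r ih => cases s with
    | nil => simp
    | cons b s =>
      refine ⟨h 0 (by simp), ih (by simpa using hl) fun j hj => ?_⟩
      exact h (j + 1) (Nat.succ_lt_succ hj)

theorem IsSemistandard.ne_nil {P : List (List α)} (h : IsSemistandard P) {r : List α}
    (hr : r ∈ P) : r ≠ [] := by
  induction P with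
  | nil => simp at hr
  | cons q P ih =>
    rcases List.mem_cons.1 hr with rfl | hr
    · exact h.1
    · exact ih h.2.2.2 hr

/-! ### Row insertion -/

theorem rowInsert_perm (x : α) (r : List α) :
    ((rowInsert x r).1 ++ (rowInsert x r).2.toList).Perm (x :: r) := by
  induction r with
  | nil => simp [rowInsert]
  | cons a r ih =>
    by_cases h : x < a
    · simp [rowInsert, h]
    · simp only [rowInsert, h, if_false]
      exact (ih.cons a).trans (List.Perm.swap x a r)

theorem rowInsert_eq_append {x : α} {r : List α} (h : (rowInsert x r).2 = none) :
    (rowInsert x r).1 = r ++ [x] := by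
  induction r with
  | nil => rfl
  | cons a r ih =>
    by_cases hx : x < a
    · simp [rowInsert, hx] at h
    · simp only [rowInsert, hx, if_false] at h ⊢
      simp [ih h]

theorem rowInsert_of_forall_le {x : α} {r : List α} (h : ∀ a ∈ r, a ≤ x) :
    rowInsert x r = (r ++ [x], none) := by
  induction r with
  | nil => rfl
  | cons a r ih =>
    have ha : ¬ x < a := not_lt.2 (h a (by simp))
    simp [rowInsert, ha, ih fun b hb => h b (by simp [hb])]

theorem rowInsert_length {x y : α} {r : List α} (h : (rowInsert x r).2 = some y) :
    (rowInsert x r).1.length = r.length := by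
  have := (rowInsert_perm x r).length_eq
  simpa [h] using this

theorem rowInsert_ne_nil (x : α) (r : List α) : (rowInsert x r).1 ≠ [] := by
  cases r with
  | nil => simp [rowInsert]
  | cons a r => by_cases h : x < a <;> simp [rowInsert, h]

theorem mem_rowInsert_self (x : α) (r : List α) : x ∈ (rowInsert x r).1 := by
  induction r with
  | nil => simp [rowInsert]
  | cons a r ih => by_cases h : x < a <;> simp [rowInsert, h, ih]

theorem mem_of_mem_rowInsert {x a : α} {r : List α} (h : a ∈ (rowInsert x r).1) :
    a = x ∨ a ∈ r := by
  have := (rowInsert_perm x r).mem_iff (a := a)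
  simpa using this.1 (by simp [h])

theorem lt_of_rowInsert {x y : α} {r : List α} (h : (rowInsert x r).2 = some y) : x < y := by
  induction r with
  | nil => simp [rowInsert] at h
  | cons a r ih =>
    by_cases hx : x < a
    · simp only [rowInsert, hx, if_true, Option.some.injEq] at h
      exact h ▸ hx
    · simp only [rowInsert, hx, if_false] at h
      exact ih h

theorem rowInsert_pairwise (x : α) {r : List α} (hr : r.Pairwise (· ≤ ·)) :
    (rowInsert x r).1.Pairwise (· ≤ ·) := by
  induction r with
  | nil => simp [rowInsert]
  | cons a r ih =>
    rw [List.pairwise_cons] at hr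
    by_cases hx : x < a
    · simp only [rowInsert, hx, if_true, List.pairwise_cons]
      exact ⟨fun b hb => hx.le.trans (hr.1 b hb), hr.2⟩
    · simp only [rowInsert, hx, if_false, List.pairwise_cons]
      refine ⟨fun b hb => ?_, ih hr.2⟩
      rcases mem_of_mem_rowInsert hb with rfl | hb
      · exact not_lt.1 hx
      · exact hr.1 b hb

/-- Replacing an entry of the upper row by a smaller one preserves `Above`. -/
theorem Above.rowInsert_left {x y : α} {r s : List α} (h : Above r s)
    (hy : (rowInsert x r).2 = some y) : Above (rowInsert x r).1 s := by
  induction r generalizing s with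
  | nil => simp [rowInsert] at hy
  | cons a r ih => cases s with
    | nil => simp
    | cons b s =>
      by_cases hx : x < a
      · simpa [rowInsert, hx] using ⟨hx.trans h.1, h.2⟩
      · simp only [rowInsert, hx, if_false] at hy ⊢
        exact ⟨h.1, ih h.2 hy⟩

theorem Above.append_left {r s : List α} (h : Above r s) (t : List α) : Above (r ++ t) s := by
  induction r generalizing s with
  | nil => cases s with
    | nil => simp
    | cons b s => exact absurd h (not_nil_above_cons b s)
  | cons a r ih => cases s with
    | nil => simp
    | cons b s => exact ⟨h.1, ih h.2⟩

/-- The bumped letter lands weakly to the left of the column it was bumped from, hence below a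
smaller entry. -/
theorem Above.rowInsert_rowInsert {x y : α} {r s : List α} (h : Above r s)
    (hy : (rowInsert x r).2 = some y) : Above (rowInsert x r).1 (rowInsert y s).1 := by
  induction r generalizing s with
  | nil => simp [rowInsert] at hy
  | cons a r ih =>
    by_cases hx : x < a
    · simp only [rowInsert, hx, if_true, Option.some.injEq] at hy ⊢
      subst hy
      cases s with
      | nil => simpa [rowInsert] using hx
      | cons b s => simpa [rowInsert, h.1] using ⟨hx, h.2⟩
    · simp only [rowInsert, hx, if_false] at hy ⊢
      have hay : a < y := (not_lt.1 hx).trans_lt (lt_of_rowInsert hy)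
      cases s with
      | nil => simpa [rowInsert] using hay
      | cons b s =>
        by_cases hb : y < b
        · simpa [rowInsert, hb] using ⟨hay, h.2.rowInsert_left hy⟩
        · simpa [rowInsert, hb] using ⟨h.1, ih h.2 hy⟩

/-- Row insertion with a bump is injective: the bumped letter determines where the inserted one
landed, at the rightmost entry smaller than the bumped letter. -/
theorem rowInsert_inj {x x' y : α} {r r' : List α} (hr : r.Pairwise (· ≤ ·))
    (hr' : r'.Pairwise (· ≤ ·)) (h : (rowInsert x r).1 = (rowInsert x' r').1)
    (hy : (rowInsert x r).2 = some y) (hy' : (rowInsert x' r').2 = some y) :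
    x = x' ∧ r = r' := by
  induction r generalizing r' with
  | nil => simp [rowInsert] at hy
  | cons a r ih => cases r' with
    | nil => simp [rowInsert] at hy'
    | cons a' r' =>
      rw [List.pairwise_cons] at hr hr'
      by_cases hx : x < a <;> by_cases hx' : x' < a' <;>
        simp only [rowInsert, hx, hx', if_true, if_false, Option.some.injEq, List.cons.injEq]
          at h hy hy' ⊢
      · exact ⟨h.1, hy.trans hy'.symm, h.2⟩
      · have := hr.1 x' (h.2 ▸ mem_rowInsert_self x' r')
        exact absurd (lt_of_rowInsert hy') (not_lt.2 (hy ▸ this))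
      · have := hr'.1 x (h.2 ▸ mem_rowInsert_self x r)
        exact absurd (lt_of_rowInsert hy) (not_lt.2 (hy' ▸ this))
      · exact ⟨(ih hr.2 hr'.2 h.2 hy hy').1, h.1, (ih hr.2 hr'.2 h.2 hy hy').2⟩

/-- Reverse bumping: if `y` has been removed from the row below `r`, leaving `s`, it can be
moved back up into `r`. -/
theorem exists_rowInsert_eq {y : α} {r s : List α} (hr : r.Pairwise (· ≤ ·))
    (hs : s.Pairwise (· ≤ ·)) (h : Above r (rowInsert y s).1) :
    ∃ x r₀, rowInsert x r₀ = (r, some y) ∧ r₀.Pairwise (· ≤ ·) ∧ Above r₀ s := by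
  induction r generalizing s with
  | nil =>
    have := h.length_le
    exact absurd (by simpa using this) (rowInsert_ne_nil y s)
  | cons a r ih =>
    rw [List.pairwise_cons] at hr
    have hay : a < y := by
      cases s with
      | nil => exact h.1
      | cons b s =>
        by_cases hb : y < b
        · simp only [rowInsert, hb, if_true] at h
          exact h.1
        · simp only [rowInsert, hb, if_false] at h
          exact h.1.trans_le (not_lt.1 hb)
    by_cases hc : ∃ c ∈ r.head?, c < y
    · -- the rightmost entry smaller than `y` lies in `r`
      obtain ⟨c, hcr, hcy⟩ := hc
      obtain ⟨r, rfl⟩ : ∃ r₁, r = c :: r₁ := by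
        cases r with
        | nil => simp at hcr
        | cons d r => exact ⟨r, by simpa using hcr⟩
      have key : Above (c :: r) (rowInsert y s.tail).1 := by
        cases s with
        | nil => simpa [rowInsert] using hcy
        | cons b s =>
          by_cases hb : y < b
          · simp only [rowInsert, hb, if_true] at h
            cases s with
            | nil => simpa [rowInsert] using hcy
            | cons d s =>
              have hd : y < d := hb.trans_le ((List.pairwise_cons.1 hs).1 d (by simp))
              simpa [rowInsert, hd] using ⟨hcy, h.2.2⟩
          · simp only [rowInsert, hb, if_false] at h
            exact h.2
      obtain ⟨x, r₀, hx, hr₀, hab⟩ := ih hr.2 hs.tail key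
      have hx1 : (rowInsert x r₀).1 = c :: r := by rw [hx]
      have hx2 : (rowInsert x r₀).2 = some y := by rw [hx]
      have hax : a ≤ x := hr.1 x (hx1 ▸ mem_rowInsert_self x r₀)
      refine ⟨x, a :: r₀, ?_, ?_, ?_⟩
      · simp [rowInsert, not_lt.2 hax, hx]
      · refine List.pairwise_cons.2 ⟨fun b hb => ?_, hr₀⟩
        have := (rowInsert_perm x r₀).mem_iff (a := b)
        rw [hx] at this
        have := this.2 (by simp [hb])
        rcases List.mem_append.1 this with h' | h'
        · exact hr.1 b h'
        · obtain rfl : b = y := by simpa [eq_comm] using h'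
          exact hay.le
      · cases s with
        | nil => simp
        | cons b s =>
          refine ⟨?_, hab⟩
          by_cases hb : y < b
          · exact hay.trans hb
          · simp only [rowInsert, hb, if_false] at h
            exact h.1
    · -- the rightmost entry smaller than `y` is `a`
      have hyr : ∀ c ∈ r, y ≤ c := by
        cases r with
        | nil => simp
        | cons d r =>
          have hd : y ≤ d := by simpa using hc
          intro c hcr
          rcases List.mem_cons.1 hcr with rfl | hcr
          · exact hd
          · exact hd.trans ((List.pairwise_cons.1 hr.2).1 c hcr)
      refine ⟨a, y :: r, by simp [rowInsert, hay], List.pairwise_cons.2 ⟨hyr, hr.2⟩, ?_⟩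
      cases s with
      | nil => simp
      | cons b s =>
        by_cases hb : y < b
        · simp only [rowInsert, hb, if_true] at h
          exact ⟨hb, h.2⟩
        · simp only [rowInsert, hb, if_false] at h
          exfalso
          have h2 := h.2
          cases r with
          | nil =>
            have := h2.length_le
            exact rowInsert_ne_nil y s (by simpa using this)
          | cons d r =>
            have hd := hyr d (by simp)
            cases s with
            | nil => exact absurd h2.1 (not_lt.2 hd)
            | cons e s =>
              by_cases he : y < e
              · simp only [rowInsert, he, if_true] at h2
                exact absurd h2.1 (not_lt.2 hd)
              · simp only [rowInsert, he, if_false] at h2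
                exact absurd (h2.1.trans_le (not_lt.1 he)) (not_lt.2 hd)

/-! ### Insertion in a tableau -/

theorem tableauInsert_of_none {x : α} {r : List α} {P : List (List α)}
    (h : (rowInsert x r).2 = none) :
    tableauInsert x (r :: P) = ((r ++ [x]) :: P, 0) := by
  have : rowInsert x r = (r ++ [x], none) := Prod.ext (rowInsert_eq_append h) h
  simp [tableauInsert, this]

theorem tableauInsert_of_some {x y : α} {r : List α} {P : List (List α)}
    (h : (rowInsert x r).2 = some y) :
    tableauInsert x (r :: P) =
      ((rowInsert x r).1 :: (tableauInsert y P).1, (tableauInsert y P).2 + 1) := by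
  have : rowInsert x r = ((rowInsert x r).1, some y) := Prod.ext rfl h
  rw [tableauInsert, this]

theorem tableauInsert_headD (x : α) (P : List (List α)) :
    (tableauInsert x P).1.headD [] = (rowInsert x (P.headD [])).1 := by
  cases P with
  | nil => rfl
  | cons r P =>
    rcases h : (rowInsert x r).2 with _ | y
    · simp [tableauInsert_of_none h, rowInsert_eq_append h]
    · simp [tableauInsert_of_some h]

theorem tableauInsert_snd_le (x : α) (P : List (List α)) :
    (tableauInsert x P).2 ≤ P.length := by
  induction P generalizing x with
  | nil => simp [tableauInsert]
  | cons r P ih =>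
    rcases h : (rowInsert x r).2 with _ | y
    · simp [tableauInsert_of_none h]
    · simpa [tableauInsert_of_some h] using ih y

theorem tableauInsert_perm (x : α) (P : List (List α)) :
    (tableauInsert x P).1.flatten.Perm (x :: P.flatten) := by
  induction P generalizing x with
  | nil => simp [tableauInsert]
  | cons r P ih =>
    have hp := rowInsert_perm x r
    rcases h : (rowInsert x r).2 with _ | y
    · simp [tableauInsert_of_none h]
    · rw [h] at hp
      simp only [tableauInsert_of_some h, List.flatten_cons]
      refine ((ih y).append_left _).trans ?_
      simpa using hp.append_right P.flatten

/-- The row reported by `tableauInsert` is the one that has grown: labelling it keeps the two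
tableaux of the correspondence of the same shape. -/
theorem tableauInsert_shape (x : α) (k : ℕ) {P : List (List α)} {Q : List (List ℕ)}
    (h : P.map List.length = Q.map List.length) :
    (tableauInsert x P).1.map List.length =
      (addToRow k (tableauInsert x P).2 Q).map List.length := by
  induction P generalizing x Q with
  | nil =>
    obtain rfl : Q = [] := by simpa using h.symm
    rfl
  | cons r P ih => cases Q with
    | nil => simp at h
    | cons q Q =>
      simp only [List.map_cons, List.cons.injEq] at h
      rcases hy : (rowInsert x r).2 with _ | y
      · simp [tableauInsert_of_none hy, addToRow, h]
      · simp [tableauInsert_of_some hy, addToRow, rowInsert_length hy, h.1, ih y h.2]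

theorem IsSemistandard.tableauInsert {P : List (List α)} (h : IsSemistandard P) (x : α) :
    IsSemistandard (tableauInsert x P).1 := by
  induction P generalizing x with
  | nil => simp [RSKCube.tableauInsert, IsSemistandard]
  | cons r P ih =>
    obtain ⟨h1, h2, h3, h4⟩ := h
    rcases hy : (rowInsert x r).2 with _ | y
    · rw [tableauInsert_of_none hy]
      exact ⟨by simp, rowInsert_eq_append hy ▸ rowInsert_pairwise x h2, h3.append_left _, h4⟩
    · rw [tableauInsert_of_some hy]
      refine ⟨rowInsert_ne_nil x r, rowInsert_pairwise x h2, ?_, ih h4 y⟩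
      rw [tableauInsert_headD]
      exact h3.rowInsert_rowInsert hy

/-- Insertion is injective on semistandard tableaux as soon as the row that grows is recorded. -/
theorem tableauInsert_inj {x x' : α} {P P' : List (List α)} (hP : IsSemistandard P)
    (hP' : IsSemistandard P') (h : RSKCube.tableauInsert x P = RSKCube.tableauInsert x' P') :
    x = x' ∧ P = P' := by
  induction P generalizing x x' P' with
  | nil => cases P' with
    | nil => simpa [tableauInsert] using h
    | cons r' P' =>
      rcases hy : (rowInsert x' r').2 with _ | y
      · rw [tableauInsert_of_none hy] at h
        have := hP'.1
        cases r' <;> simp_all [tableauInsert]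
      · rw [tableauInsert_of_some hy] at h
        simp [tableauInsert] at h
  | cons r P ih => cases P' with
    | nil =>
      rcases hy : (rowInsert x r).2 with _ | y
      · rw [tableauInsert_of_none hy] at h
        have := hP.1
        cases r <;> simp_all [tableauInsert]
      · rw [tableauInsert_of_some hy] at h
        simp [tableauInsert] at h
    | cons r' P' =>
      rcases hy : (rowInsert x r).2 with _ | y <;> rcases hy' : (rowInsert x' r').2 with _ | y'
      · rw [tableauInsert_of_none hy, tableauInsert_of_none hy'] at h
        simp only [Prod.mk.injEq, List.cons.injEq, and_true] at h
        have := List.append_inj' h.1 rfl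
        simp_all
      · simp [tableauInsert_of_none hy, tableauInsert_of_some hy'] at h
      · simp [tableauInsert_of_none hy', tableauInsert_of_some hy] at h
      · rw [tableauInsert_of_some hy, tableauInsert_of_some hy'] at h
        simp only [Prod.mk.injEq, List.cons.injEq, Nat.add_right_cancel_iff] at h
        obtain ⟨rfl, rfl⟩ := ih hP.2.2.2 hP'.2.2.2 (Prod.ext h.1.2 h.2)
        obtain ⟨rfl, rfl⟩ := rowInsert_inj hP.2.1 hP'.2.1 h.1.1 hy hy'
        exact ⟨rfl, rfl⟩

/-- Reverse insertion: a semistandard tableau whose shape is that of `Q` with a cell added at the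
end of the row `i` arises by an insertion into a semistandard tableau of the shape of `Q`. -/
theorem exists_tableauInsert_eq {k i : ℕ} {Q : List (List ℕ)} {P : List (List α)}
    (hQ : IsSemistandard Q) (hi : i ≤ Q.length) (hP : IsSemistandard P)
    (h : P.map List.length = (addToRow k i Q).map List.length) :
    ∃ x P₀, tableauInsert x P₀ = (P, i) ∧ IsSemistandard P₀ ∧
      P₀.map List.length = Q.map List.length := by
  induction Q generalizing i P with
  | nil =>
    obtain rfl : i = 0 := by simpa using hi
    obtain ⟨p, rfl⟩ : ∃ p, P = [p] := List.length_eq_one_iff.1 (by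
      simpa [addToRow] using congrArg List.length h)
    obtain ⟨x, rfl⟩ : ∃ x, p = [x] := List.length_eq_one_iff.1 (by
      simpa [addToRow] using h)
    exact ⟨x, [], rfl, trivial, rfl⟩
  | cons q Q ih => cases P with
    | nil => cases i <;> simp [addToRow] at h
    | cons p P =>
      obtain ⟨q1, q2, q3, q4⟩ := hQ
      obtain ⟨p1, p2, p3, p4⟩ := hP
      cases i with
      | zero =>
        simp only [addToRow, List.map_cons, List.cons.injEq, List.length_append,
          List.length_singleton] at h
        obtain ⟨p, x, rfl⟩ : ∃ p₀ x, p = p₀ ++ [x] :=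
          ⟨p.dropLast, p.getLast p1, (List.dropLast_append_getLast p1).symm⟩
        have hlen : p.length = q.length := by simpa using h.1
        have hx : rowInsert x p = (p ++ [x], none) :=
          rowInsert_of_forall_le fun a ha => (List.pairwise_append.1 p2).2.2 a ha x (by simp)
        refine ⟨x, p :: P, tableauInsert_of_none (by rw [hx]), ⟨?_, ?_, ?_, p4⟩, ?_⟩
        · exact fun hp => q1 (List.length_eq_zero_iff.1 (by simp [← hlen, hp]))
        · exact (List.pairwise_append.1 p2).1
        · refine p3.of_append_left ?_
          have h2 : (P.headD []).length = (Q.headD []).length := by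
            cases P <;> cases Q <;> simp_all
          rw [h2, hlen]
          exact q3.length_le
        · simp [hlen, h.2]
      | succ i =>
        simp only [addToRow, List.map_cons, List.cons.injEq] at h
        obtain ⟨y, P₀, hy, hP₀, hs⟩ := ih q4 (by simpa using hi) p4 h.2
        have hhead := tableauInsert_headD y P₀
        rw [hy] at hhead
        have hsorted : (P₀.headD []).Pairwise (· ≤ ·) := by
          cases P₀ with
          | nil => simp
          | cons r P₀ => exact hP₀.2.1
        obtain ⟨x, r, hx, hr, hab⟩ := exists_rowInsert_eq p2 hsorted (hhead ▸ p3)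
        have hx2 : (rowInsert x r).2 = some y := by rw [hx]
        have hrl : r.length = p.length := by
          have := rowInsert_length hx2
          rw [hx] at this
          exact this.symm
        refine ⟨x, r :: P₀, ?_, ⟨?_, hr, hab, hP₀⟩, ?_⟩
        · rw [tableauInsert_of_some hx2, hx, hy]
        · rintro rfl
          exact p1 (List.length_eq_zero_iff.1 hrl.symm)
        · simp [hrl, h.1, hs]

/-! ### Recording tableaux -/

theorem addToRow_perm (k i : ℕ) (Q : List (List ℕ)) :
    (addToRow k i Q).flatten.Perm (k :: Q.flatten) := by
  induction Q generalizing i with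
  | nil => cases i <;> simp [addToRow]
  | cons q Q ih => cases i with
    | zero => simp [addToRow]
    | succ i =>
      simp only [addToRow, List.flatten_cons]
      exact ((ih i).append_left q).trans (by simp)

theorem addToRow_inj {k i i' : ℕ} {Q Q' : List (List ℕ)} (hk : k ∉ Q.flatten)
    (hk' : k ∉ Q'.flatten) (hQ : ∀ r ∈ Q, r ≠ []) (hQ' : ∀ r ∈ Q', r ≠ [])
    (hi : i ≤ Q.length) (hi' : i' ≤ Q'.length) (h : addToRow k i Q = addToRow k i' Q') :
    i = i' ∧ Q = Q' := by
  induction Q generalizing i i' Q' with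
  | nil =>
    obtain rfl : i = 0 := by simpa using hi
    cases Q' with
    | nil => exact ⟨(Nat.le_zero.1 hi').symm, rfl⟩
    | cons q' Q' => cases i' with
      | zero => simp_all [addToRow]
      | succ i' =>
        simp only [addToRow, List.cons.injEq] at h
        simp [← h.1] at hk'
  | cons q Q ih => cases Q' with
    | nil =>
      obtain rfl : i' = 0 := by simpa using hi'
      cases i with
      | zero => simp_all [addToRow]
      | succ i =>
        simp only [addToRow, List.cons.injEq] at h
        simp [h.1] at hk
    | cons q' Q' =>
      cases i with
      | zero => cases i' with
        | zero => simpa [addToRow] using h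
        | succ i' =>
          simp only [addToRow, List.cons.injEq] at h
          simp [← h.1] at hk'
      | succ i => cases i' with
        | zero =>
          simp only [addToRow, List.cons.injEq] at h
          simp [h.1] at hk
        | succ i' =>
          simp only [addToRow, List.cons.injEq] at h
          have := ih (by simp_all) (by simp_all) (fun r hr => hQ r (by simp [hr]))
            (fun r hr => hQ' r (by simp [hr])) (by simpa using hi) (by simpa using hi') h.2
          simp [h.1, this.1, this.2]

theorem addToRow_headD (k i : ℕ) (Q : List (List ℕ)) :
    ∃ t, (addToRow k i Q).headD [] = Q.headD [] ++ t := by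
  cases Q with
  | nil => cases i <;> exact ⟨[k], rfl⟩
  | cons q Q => cases i with
    | zero => exact ⟨[k], rfl⟩
    | succ i => exact ⟨[], by simp [addToRow]⟩

/-- The largest label of a standard tableau lies at the end of a row, and the tableau stays
semistandard when it is removed. -/
theorem exists_addToRow_eq {k : ℕ} {Q : List (List ℕ)} (hQ : IsSemistandard Q)
    (hk : k ∈ Q.flatten) (hmax : ∀ a ∈ Q.flatten, a ≤ k) (hnd : Q.flatten.Nodup) :
    ∃ i Q₀, addToRow k i Q₀ = Q ∧ IsSemistandard Q₀ ∧ i ≤ Q₀.length := by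
  induction Q with
  | nil => simp at hk
  | cons q Q ih =>
    obtain ⟨q1, q2, q3, q4⟩ := hQ
    rw [List.flatten_cons] at hk hmax hnd
    have hnd' := List.nodup_append.1 hnd
    by_cases hkq : k ∈ q
    · obtain ⟨q, x, rfl⟩ : ∃ q₀ x, q = q₀ ++ [x] :=
        ⟨q.dropLast, q.getLast q1, (List.dropLast_append_getLast q1).symm⟩
      obtain rfl : x = k := by
        rcases List.mem_append.1 hkq with h | h
        · exact le_antisymm (hmax x (by simp))
            ((List.pairwise_append.1 q2).2.2 k h x (by simp))
        · simpa [eq_comm] using h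
      -- no entry stands below the largest one
      have hab : Above q (Q.headD []) := by
        refine q3.of_append_left ?_
        by_contra! hlt
        have hle := q3.length_le
        have h0 := q3.getD_lt (j := q.length) hlt
        have hmem : (Q.headD []).getD q.length 0 ∈ Q.flatten := by
          rw [List.getD_eq_getElem _ _ hlt]
          cases Q with
          | nil => simp at hlt
          | cons q' Q => simp
        have := hmax _ (List.mem_append_right _ hmem)
        rw [List.getD_append_right _ _ _ _ le_rfl] at h0
        simp only [Nat.sub_self, List.getD_cons_zero] at h0
        omega
      by_cases hq : q = []
      · subst hq
        cases Q with
        | nil => exact ⟨0, [], rfl, trivial, le_rfl⟩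
        | cons q' Q =>
          have := hab.length_le
          exact absurd (List.length_eq_zero_iff.1 (by simpa using this)) q4.1
      · exact ⟨0, q :: Q, rfl, ⟨hq, (List.pairwise_append.1 q2).1, hab, q4⟩, by simp⟩
    · obtain ⟨i, Q₀, rfl, h1, h2⟩ := ih q4 ((List.mem_append.1 hk).resolve_left hkq)
        (fun a ha => hmax a (List.mem_append_right _ ha)) hnd'.2.1
      obtain ⟨t, ht⟩ := addToRow_headD k i Q₀
      exact ⟨i + 1, q :: Q₀, rfl, ⟨q1, q2, (ht ▸ q3).of_append_right, h1⟩, by simpa using h2⟩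

/-! ### The RSK correspondence -/

theorem rsk_append_singleton (u : List α) (x : α) :
    rsk (u ++ [x]) = rskStep (rsk u) (x, u.length + 1) := by
  simp [rsk, List.zipIdx_append, add_comm]

theorem rsk_fst_isSemistandard (u : List α) : IsSemistandard (rsk u).1 := by
  induction u using List.reverseRecOn with
  | nil => trivial
  | append_singleton u x ih =>
    rw [rsk_append_singleton]
    exact ih.tableauInsert x

theorem rsk_shape (u : List α) :
    (rsk u).1.map List.length = (rsk u).2.map List.length := by
  induction u using List.reverseRecOn with
  | nil => rfl
  | append_singleton u x ih =>
    rw [rsk_append_singleton]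
    exact tableauInsert_shape x _ ih

theorem rsk_fst_perm (u : List α) : (rsk u).1.flatten.Perm u := by
  induction u using List.reverseRecOn with
  | nil => simp [rsk]
  | append_singleton u x ih =>
    rw [rsk_append_singleton]
    exact (tableauInsert_perm x _).trans ((ih.cons x).trans (List.perm_append_singleton x u).symm)

theorem rsk_snd_perm (u : List α) : (rsk u).2.flatten.Perm (List.range' 1 u.length) := by
  induction u using List.reverseRecOn with
  | nil => simp [rsk]
  | append_singleton u x ih =>
    rw [rsk_append_singleton]
    refine (addToRow_perm _ _ _).trans ((ih.cons _).trans ?_)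
    rw [List.length_append, List.length_singleton, List.range'_1_concat, add_comm 1]
    exact (List.perm_append_singleton _ _).symm

theorem rsk_snd_ne_nil (u : List α) : ∀ r ∈ (rsk u).2, r ≠ [] := by
  rintro r hr rfl
  have : 0 ∈ (rsk u).1.map List.length := by
    rw [rsk_shape]
    exact List.mem_map.2 ⟨[], hr, rfl⟩
  obtain ⟨s, hs, hs0⟩ := List.mem_map.1 this
  exact (rsk_fst_isSemistandard u).ne_nil hs (List.length_eq_zero_iff.1 hs0)

theorem length_rsk_snd (u : List α) : (rsk u).2.length = (rsk u).1.length := by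
  simpa using (congrArg List.length (rsk_shape u)).symm

/-- The last step of RSK can be undone: the largest label of the recording tableau tells which row
has grown, and insertion is injective once that row is known. -/
theorem rsk_injective : Function.Injective (rsk : List α → _) := by
  intro u
  induction u using List.reverseRecOn with
  | nil =>
    intro u' h
    have := rsk_fst_perm u'
    rw [← h] at this
    simpa [rsk, eq_comm] using this
  | append_singleton u x ih =>
    intro u' h
    have hlen : u'.length = u.length + 1 := by
      have h1 := (rsk_fst_perm u').length_eq
      rw [← h, (rsk_fst_perm _).length_eq] at h1
      simpa using h1.symm
    obtain ⟨u', x', rfl⟩ : ∃ u₀ x', u' = u₀ ++ [x'] := by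
      have hne : u' ≠ [] := by
        rintro rfl
        simp at hlen
      exact ⟨_, _, (List.dropLast_append_getLast hne).symm⟩
    have hlen' : u'.length = u.length := by simpa using hlen
    have hfresh : ∀ v : List α, v.length + 1 ∉ (rsk v).2.flatten := fun v hv => by
      have := (rsk_snd_perm v).mem_iff.1 hv
      simp [List.mem_range'_1] at this
      omega
    have hidx : ∀ (v : List α) (y : α), (tableauInsert y (rsk v).1).2 ≤ (rsk v).2.length :=
      fun v y => length_rsk_snd v ▸ tableauInsert_snd_le y _
    rw [rsk_append_singleton, rsk_append_singleton, hlen'] at h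
    simp only [rskStep, Prod.mk.injEq] at h
    obtain ⟨hi, hQ⟩ := addToRow_inj (hfresh u) (hlen' ▸ hfresh u') (rsk_snd_ne_nil u)
      (rsk_snd_ne_nil u') (hidx u x) (hidx u' x') h.2
    obtain ⟨rfl, hP⟩ := tableauInsert_inj (rsk_fst_isSemistandard u) (rsk_fst_isSemistandard u')
      (Prod.ext h.1 hi)
    rw [ih (Prod.ext hP hQ)]

/-- Every pair of a semistandard and a standard tableau of the same shape is in the image of the
RSK correspondence. -/
theorem exists_rsk_eq {n : ℕ} {P : List (List α)} {Q : List (List ℕ)} (hP : IsSemistandard P)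
    (hQ : IsSemistandard Q) (hperm : Q.flatten.Perm (List.range' 1 n))
    (h : P.map List.length = Q.map List.length) : ∃ u, rsk u = (P, Q) := by
  suffices H : ∃ u, rsk u = (P, Q) ∧ u.length = n from H.imp fun _ hu => hu.1
  induction n generalizing P Q with
  | zero =>
    have hQ0 : Q = [] := by
      cases Q with
      | nil => rfl
      | cons q Q =>
        have : q = [] ∧ ∀ l ∈ Q, l = [] := by simpa using hperm
        exact absurd this.1 hQ.1
    subst hQ0
    obtain rfl : P = [] := by simpa using h
    exact ⟨[], rfl, rfl⟩
  | succ n ih =>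
    obtain ⟨i, Q₀, rfl, hQ₀, hi⟩ := exists_addToRow_eq (k := n + 1) hQ
      (hperm.mem_iff.2 (by simp [List.mem_range'_1]))
      (fun a ha => by
        have := hperm.mem_iff.1 ha
        simp [List.mem_range'_1] at this
        omega)
      (hperm.nodup_iff.2 List.nodup_range')
    obtain ⟨x, P₀, hx, hP₀, hs⟩ := exists_tableauInsert_eq hQ₀ hi hP h
    have hperm₀ : Q₀.flatten.Perm (List.range' 1 n) := by
      have h1 := (addToRow_perm (n + 1) i Q₀).symm.trans hperm
      rw [List.range'_1_concat, add_comm 1] at h1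
      exact (h1.trans (List.perm_append_singleton _ _)).cons_inv
    obtain ⟨u, hu, hl⟩ := ih hP₀ hQ₀ hperm₀ hs
    refine ⟨u ++ [x], ?_, by simp [hl]⟩
    rw [rsk_append_singleton, hu, hl, rskStep, hx]

/-! ### Invariance under strictly increasing maps -/

section Map

variable {β : Type*} [LinearOrder β] {f : α → β}

theorem rowInsert_map (hf : StrictMono f) (x : α) (r : List α) :
    rowInsert (f x) (r.map f) = ((rowInsert x r).1.map f, (rowInsert x r).2.map f) := by
  induction r with
  | nil => rfl
  | cons a r ih => by_cases h : x < a <;> simp [rowInsert, hf.lt_iff_lt, h, ih]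

theorem tableauInsert_map (hf : StrictMono f) (x : α) (P : List (List α)) :
    tableauInsert (f x) (P.map (List.map f)) =
      ((tableauInsert x P).1.map (List.map f), (tableauInsert x P).2) := by
  induction P generalizing x with
  | nil => rfl
  | cons r P ih =>
    rcases h : (rowInsert x r).2 with _ | y
    · rw [List.map_cons, tableauInsert_of_none (by rw [rowInsert_map hf, h]; rfl),
        tableauInsert_of_none h]
      simp
    · rw [List.map_cons, tableauInsert_of_some (y := f y) (by rw [rowInsert_map hf, h]; rfl),
        tableauInsert_of_some h, ih, rowInsert_map hf]
      simp

theorem rsk_map (hf : StrictMono f) (u : List α) :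
    rsk (u.map f) = ((rsk u).1.map (List.map f), (rsk u).2) := by
  induction u using List.reverseRecOn with
  | nil => rfl
  | append_singleton u x ih =>
    rw [List.map_append, List.map_singleton, rsk_append_singleton, rsk_append_singleton, ih]
    simp [rskStep, tableauInsert_map hf]

end Map

end RSKCorrespondence

/-! ### Semistandard Young tableaux and their lists of rows -/

theorem isSemistandard_iff {α : Type*} [LinearOrder α] {P : List (List α)} :
    IsSemistandard P ↔ ∀ i < P.length, P.getD i [] ≠ [] ∧ (P.getD i []).Pairwise (· ≤ ·) ∧
      Above (P.getD i []) (P.getD (i + 1) []) := by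
  induction P with
  | nil => simp [IsSemistandard]
  | cons r P ih =>
    have h0 : P.headD [] = P.getD 0 [] := by cases P <;> rfl
    simp only [IsSemistandard, ih, h0]
    constructor
    · rintro ⟨h1, h2, h3, h4⟩ i hi
      cases i with
      | zero => exact ⟨h1, h2, h3⟩
      | succ i => exact h4 i (by simpa using hi)
    · intro h
      obtain ⟨h1, h2, h3⟩ := h 0 (by simp)
      exact ⟨h1, h2, h3, fun i hi => h (i + 1) (by simpa using hi)⟩

variable {μ : YoungDiagram}

/-- The list of the rows of a semistandard Young tableau, from top to bottom. -/
def tableauRows (T : SemistandardYoungTableau μ) : List (List ℕ) :=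
  (List.range (μ.colLen 0)).map fun i => (List.range (μ.rowLen i)).map fun j => T i j

theorem rowLen_eq_zero {i : ℕ} (h : μ.colLen 0 ≤ i) : μ.rowLen i = 0 := by
  by_contra hne
  have : (i, 0) ∈ μ := YoungDiagram.mem_iff_lt_rowLen.2 (Nat.pos_of_ne_zero hne)
  exact absurd (YoungDiagram.mem_iff_lt_colLen.1 this) (not_lt.2 h)

theorem tableauRows_shape (T : SemistandardYoungTableau μ) :
    (tableauRows T).map List.length = (List.range (μ.colLen 0)).map μ.rowLen := by
  simp [tableauRows, Function.comp_def]

theorem tableauRows_getD (T : SemistandardYoungTableau μ) (i : ℕ) :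
    (tableauRows T).getD i [] = (List.range (μ.rowLen i)).map fun j => T i j := by
  by_cases h : i < μ.colLen 0
  · rw [List.getD_eq_getElem _ _ (by simpa [tableauRows] using h)]
    simp [tableauRows]
  · rw [List.getD_eq_default _ _ (by simpa [tableauRows] using h),
      rowLen_eq_zero (not_lt.1 h)]
    rfl

theorem tableauRows_injective :
    Function.Injective (tableauRows : SemistandardYoungTableau μ → _) := by
  intro T T' h
  apply SemistandardYoungTableau.ext
  intro i j
  by_cases hc : (i, j) ∈ μ
  · have h1 := congrArg (fun L => (L.getD i []).getD j 0) h
    have hj := YoungDiagram.mem_iff_lt_rowLen.1 hc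
    simp only [tableauRows_getD] at h1
    rwa [List.getD_eq_getElem _ _ (by simpa using hj), List.getD_eq_getElem _ _ (by simpa using hj),
      List.getElem_map, List.getElem_map, List.getElem_range] at h1
  · rw [T.zeros hc, T'.zeros hc]

theorem tableauRows_isSemistandard (T : SemistandardYoungTableau μ) :
    IsSemistandard (tableauRows T) := by
  rw [isSemistandard_iff]
  intro i hi
  rw [tableauRows_getD, tableauRows_getD]
  refine ⟨?_, ?_, ?_⟩
  · have : (i, 0) ∈ μ := YoungDiagram.mem_iff_lt_colLen.2 (by simpa [tableauRows] using hi)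
    have := YoungDiagram.mem_iff_lt_rowLen.1 this
    simp [this.ne']
  · rw [List.pairwise_map]
    refine List.pairwise_lt_range.imp_of_mem fun {a b} _ hb hab => ?_
    exact T.row_weak hab (YoungDiagram.mem_iff_lt_rowLen.2 (List.mem_range.1 hb))
  · refine above_of_getElem (by simpa using μ.rowLen_anti i (i + 1) i.le_succ) fun j hj => ?_
    simp only [List.getElem_map, List.getElem_range]
    exact T.col_strict i.lt_succ_self (YoungDiagram.mem_iff_lt_rowLen.2 (by simpa using hj))

theorem exists_tableauRows_eq {P : List (List ℕ)} (hP : IsSemistandard P)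
    (h : P.map List.length = (List.range (μ.colLen 0)).map μ.rowLen) :
    ∃ T : SemistandardYoungTableau μ, tableauRows T = P := by
  have hlen : P.length = μ.colLen 0 := by simpa using congrArg List.length h
  have hrow : ∀ i, (P.getD i []).length = μ.rowLen i := fun i => by
    by_cases hi : i < P.length
    · have := List.getElem_of_eq h (i := i) (by simpa using hi)
      rw [List.getD_eq_getElem _ _ hi]
      simpa using this
    · rw [List.getD_eq_default _ _ (not_lt.1 hi), rowLen_eq_zero (hlen ▸ not_lt.1 hi)]
      rfl
  have hlt : ∀ {i j}, (i, j) ∈ μ → i < P.length := fun {i j} hc => by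
    rw [hlen]
    exact YoungDiagram.mem_iff_lt_colLen.1 (μ.up_left_mem le_rfl (Nat.zero_le j) hc)
  rw [isSemistandard_iff] at hP
  refine ⟨⟨fun i j => (P.getD i []).getD j 0, ?_, ?_, ?_⟩, ?_⟩
  · intro i j1 j2 hj hc
    have h2 : j2 < (P.getD i []).length := hrow i ▸ YoungDiagram.mem_iff_lt_rowLen.1 hc
    rw [List.getD_eq_getElem _ _ h2, List.getD_eq_getElem _ _ (hj.trans h2)]
    exact List.pairwise_iff_getElem.1 (hP i (hlt hc)).2.1 j1 j2 (hj.trans h2) h2 hj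
  · intro i1 i2 j hi hc
    induction i2, hi using Nat.le_induction with
    | base =>
      exact (hP i1 (i1.lt_succ_self.trans (hlt hc))).2.2.getD_lt
        (hrow _ ▸ YoungDiagram.mem_iff_lt_rowLen.1 hc)
    | succ i hi ih =>
      exact (ih (μ.up_left_mem i.le_succ le_rfl hc)).trans
        ((hP i (i.lt_succ_self.trans (hlt hc))).2.2.getD_lt
          (hrow _ ▸ YoungDiagram.mem_iff_lt_rowLen.1 hc))
  · intro i j hc
    exact List.getD_eq_default _ _
      (hrow i ▸ not_lt.1 fun hj => hc (YoungDiagram.mem_iff_lt_rowLen.2 hj))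
  · refine List.ext_getElem (by simp [tableauRows, hlen]) fun i h1 h2 => ?_
    rw [← List.getD_eq_getElem _ [] h1, tableauRows_getD, ← List.getD_eq_getElem _ [] h2]
    refine List.ext_getElem (by rw [hrow]; simp) fun j h3 h4 => ?_
    rw [List.getElem_map, List.getElem_range, ← List.getD_eq_getElem _ 0 h4]
    rfl

/-- The rows of `T` contain each cell exactly once. -/
@[to_additive /-- The rows of `T` contain each cell exactly once. -/]
theorem prod_map_tableauRows_flatten {M : Type*} [CommMonoid M] (T : SemistandardYoungTableau μ)
    (f : ℕ → M) : ((tableauRows T).flatten.map f).prod = ∏ c ∈ μ.cells, f (T c.1 c.2) := by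
  have hrange : ∀ (n : ℕ) (g : ℕ → M), ((List.range n).map g).prod = ∏ i ∈ Finset.range n, g i :=
    fun _ _ => rfl
  rw [Finset.prod_finset_product' μ.cells (Finset.range (μ.colLen 0))
    (fun i => Finset.range (μ.rowLen i)) (f := fun i j => f (T i j))]
  · simp only [← hrange]
    rw [List.map_flatten, List.prod_flatten]
    simp [tableauRows, Function.comp_def]
  · rintro ⟨i, j⟩
    simp only [YoungDiagram.mem_cells, Finset.mem_range, ← YoungDiagram.mem_iff_lt_rowLen,
      ← YoungDiagram.mem_iff_lt_colLen]
    exact ⟨fun hc => ⟨μ.up_left_mem le_rfl (Nat.zero_le j) hc, hc⟩, fun hc => hc.2⟩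

theorem coe_tableauRows_flatten (T : SemistandardYoungTableau μ) :
    ((tableauRows T).flatten : Multiset ℕ) = μ.cells.val.map fun c => T c.1 c.2 := by
  have h := sum_map_tableauRows_flatten T fun a => ({a} : Multiset ℕ)
  rw [← Multiset.sum_coe, ← Multiset.map_coe, Multiset.sum_map_singleton] at h
  rw [h, ← Multiset.sum_map_singleton (μ.cells.val.map fun c => T c.1 c.2), Multiset.map_map]
  rfl

theorem SYT.rows_flatten_perm (Q : SYT μ) : Q.rows.flatten.Perm (List.range' 1 μ.card) := by
  rw [← Multiset.coe_eq_coe]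
  refine (coe_tableauRows_flatten Q.1).trans ?_
  have himage : μ.cells.image (fun c => Q.1 c.1 c.2) = Finset.Icc 1 μ.card := by
    rw [← Finset.coe_inj, Finset.coe_image, Finset.coe_Icc]
    exact Q.2.image_eq
  rw [← Finset.image_val_of_injOn Q.2.injOn, himage]
  simp [Finset.Icc, LocallyFiniteOrder.finsetIcc]

/-! ### Integer points of the chambers -/

theorem prod_X_pow_wt {n : ℕ} (T : SSYT n μ) :
    ∏ k : Fin n, (MvPolynomial.X k.val : MvPolynomial ℕ ℤ) ^ wt T k =
      ∏ c ∈ μ.cells, MvPolynomial.X (T.1 c.1 c.2) := by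
  rw [← Finset.prod_fiberwise_of_maps_to (t := Finset.range n) (g := fun c => T.1 c.1 c.2)
    (fun c hc => Finset.mem_range.2 (T.2 c hc)), Finset.prod_range]
  refine Finset.prod_congr rfl fun k _ => ?_
  rw [wt, ← Finset.prod_const]
  refine Finset.prod_congr rfl fun c hc => ?_
  rw [(Finset.mem_filter.1 hc).2]

theorem rename_schur (n : ℕ) (μ : YoungDiagram) :
    MvPolynomial.rename (Fin.val : Fin n → ℕ) (schur n μ) =
      ∑ᶠ T : SSYT n μ, ∏ c ∈ μ.cells, MvPolynomial.X (T.1 c.1 c.2) := by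
  refine (map_finsum (MvPolynomial.rename _) (Set.toFinite _)).trans (finsum_congr fun T => ?_)
  simp only [map_prod, map_pow, MvPolynomial.rename_X, prod_X_pow_wt]

theorem ofFn_cast_eq {n : ℕ} {v : Fin n → ℤ} {u : List ℕ} (hu : u.length = n)
    (hv : ∀ i : Fin n, v i = (u[i.val] : ℤ)) :
    List.ofFn (fun i => (v i : ℝ)) = u.map (Nat.cast : ℕ → ℝ) := by
  refine List.ext_getElem (by simp [hu]) fun i h1 h2 => ?_
  simp [hv]

/-- Sending a semistandard tableau `T` to the unique word with the pair of tableaux `(T, Q)` is a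
bijection onto the integer points of the chamber, and the word is a rearrangement of the entries
of `T`. -/
theorem genFun_chIn (Q : SYT μ) (h : ℕ) :
    genFun (chIn (h : ℝ) Q) =
      MvPolynomial.rename (Fin.val : Fin (h + 1) → ℕ) (schur (h + 1) μ) := by
  have hshape : ∀ T : SemistandardYoungTableau μ,
      (tableauRows T).map List.length = Q.rows.map List.length := fun T =>
    (tableauRows_shape T).trans (tableauRows_shape Q.1).symm
  have hcast : StrictMono (Nat.cast : ℕ → ℝ) := Nat.strictMono_cast
  choose u hu using fun T : SSYT (h + 1) μ =>
    exists_rsk_eq (tableauRows_isSemistandard T.1) (tableauRows_isSemistandard Q.1)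
      Q.rows_flatten_perm (hshape T.1)
  have hlen : ∀ T, (u T).length = μ.card := fun T => by
    have h1 := rsk_snd_perm (u T)
    rw [hu] at h1
    simpa using (h1.symm.trans Q.rows_flatten_perm).length_eq
  have hperm : ∀ T, (tableauRows T.1).flatten.Perm (u T) := fun T => by
    have h1 := rsk_fst_perm (u T)
    rwa [hu] at h1
  have hmem : ∀ T, ∀ a ∈ u T, a < h + 1 := fun T a ha => by
    have h1 : a ∈ ((tableauRows T.1).flatten : Multiset ℕ) := (hperm T).mem_iff.2 ha
    rw [coe_tableauRows_flatten] at h1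
    obtain ⟨c, hc, rfl⟩ := Multiset.mem_map.1 h1
    exact T.2 c hc
  have hlt : ∀ T (i : Fin μ.card), i.val < (u T).length := fun T i => (hlen T).symm ▸ i.isLt
  rw [genFun, rename_schur, ← finsum_mem_univ fun T : SSYT (h + 1) μ => _]
  symm
  refine finsum_mem_eq_of_bijOn (fun T i => ((u T)[i.val]'(hlt T i) : ℤ)) ⟨?_, ?_, ?_⟩ ?_
  · intro T _
    refine ⟨fun i => ⟨by simp, ?_⟩, ?_⟩
    · have := hmem T _ (List.getElem_mem (hlt T i))
      simpa using Nat.lt_succ_iff.1 this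
    · rw [ofFn_cast_eq (hlen T) fun i => rfl, rsk_map hcast, hu]
      rfl
  · intro T _ T' _ he
    have : u T = u T' := List.ext_getElem ((hlen T).trans (hlen T').symm) fun i h1 h2 =>
      Int.ofNat_inj.1 (congrFun he ⟨i, hlen T ▸ h1⟩)
    have := (hu T).symm.trans ((congrArg rsk this).trans (hu T'))
    exact Subtype.ext (tableauRows_injective (Prod.ext_iff.1 this).1)
  · intro v hv
    obtain ⟨hbox', hrec⟩ := hv
    have hbox : ∀ i, 0 ≤ v i ∧ v i ≤ h := fun i =>
      ⟨Int.cast_nonneg_iff.1 (hbox' i).1, by exact_mod_cast show (v i : ℝ) ≤ h from (hbox' i).2⟩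
    have hv0 : ∀ i, ((v i).toNat : ℤ) = v i := fun i =>
      Int.toNat_of_nonneg (hbox i).1
    set w : List ℕ := List.ofFn fun i => (v i).toNat with hw
    have hwlen : w.length = μ.card := by simp [hw]
    rw [ofFn_cast_eq hwlen (fun i => by simp [hw, hv0]), rsk_map hcast] at hrec
    simp only at hrec
    obtain ⟨T, hT⟩ := exists_tableauRows_eq (μ := μ) (rsk_fst_isSemistandard w)
      ((rsk_shape w).trans ((congrArg _ hrec).trans (tableauRows_shape Q.1)))
    have hTlt : ∀ c ∈ μ.cells, T c.1 c.2 < h + 1 := fun c hc => by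
      have h1 : T c.1 c.2 ∈ ((tableauRows T).flatten : Multiset ℕ) := by
        rw [coe_tableauRows_flatten]
        exact Multiset.mem_map_of_mem (fun c : ℕ × ℕ => T c.1 c.2) hc
      rw [hT] at h1
      obtain ⟨i, hi⟩ := (List.mem_ofFn' _ _).1 ((rsk_fst_perm w).mem_iff.1 h1)
      have h2 := (hbox i).2
      have h3 := hv0 i
      simp only at hi
      omega
    refine ⟨⟨T, hTlt⟩, trivial, ?_⟩
    have huw : u ⟨T, hTlt⟩ = w := rsk_injective ((hu _).trans (Prod.ext hT hrec.symm))
    funext i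
    simp [huw, hw, hv0]
  · intro T _
    have h1 : ∏ i : Fin μ.card, (MvPolynomial.X ((u T)[i.val]'(hlt T i)) : MvPolynomial ℕ ℤ) =
        ((u T).map MvPolynomial.X).prod := by
      rw [← List.prod_ofFn]
      congr 1
      exact List.ext_getElem (by simp [hlen]) fun i _ _ => by simp
    simp only [Int.toNat_natCast]
    rw [h1, ← ((hperm T).map _).prod_eq, prod_map_tableauRows_flatten]

/-- Scaling preserves the recording tableau, so that the chambers of the dilated cube are the
dilates of those of the unit cube. -/
theorem smul_chIn (Q : SYT μ) {r : ℝ} (hr : 0 < r) (s : ℝ) :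
    r • chIn s Q = chIn (r * s) Q := by
  have hmono : StrictMono (r * ·) := fun a b hab => mul_lt_mul_of_pos_left hab hr
  have hmem : ∀ v, r • v ∈ chIn (r * s) Q ↔ v ∈ chIn s Q := fun v => by
    have hof : List.ofFn (r • v) = (List.ofFn v).map (r * ·) := by
      rw [List.map_ofFn]
      rfl
    simp only [chIn, Set.mem_ofPred_eq, hof, rsk_map hmono, Pi.smul_apply, smul_eq_mul,
      mul_nonneg_iff_of_pos_left hr, mul_le_mul_iff_right₀ hr]
  ext v
  rw [Set.mem_smul_set_iff_inv_smul_mem₀ hr.ne', ← hmem, smul_inv_smul₀ hr.ne']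

end RSKCube

theorem mainTheorem11 (μ : YoungDiagram) (Q : RSKCube.SYT μ) (h : ℕ) :
    (1 ≤ h →
      RSKCube.ipe (RSKCube.Ch Q) h =
        MvPolynomial.rename (Fin.val : Fin (h + 1) → ℕ) (RSKCube.schur (h + 1) μ)) ∧
    RSKCube.genFun (RSKCube.chIn (h : ℝ) Q) =
      MvPolynomial.rename (Fin.val : Fin (h + 1) → ℕ) (RSKCube.schur (h + 1) μ) := by
  refine ⟨fun hh => ?_, RSKCube.genFun_chIn Q h⟩
  rw [RSKCube.ipe, RSKCube.Ch, RSKCube.smul_chIn Q (by exact_mod_cast hh), mul_one]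
  exact RSKCube.genFun_chIn Q h
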